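/- A metric measure space is a separable metric space with a nontrivial Borel regular measure that is finite on bounded sets. Let $(X,d_X,\mu)$ and $(Y,d_Y,\nu)$ be metric measure spaces and let $1\le q<\infty$. A $q$-weak upper gradient of $u\colon X\to\mathbb R$ is a Borel function $g\colon X\to[0,\infty]$ such that $|u(\gamma(a))-u(\gamma(b))|\le\int_\gamma g\,ds$ for all compact nonconstant rectifiable curves $\gamma\colon[a,b]\to X$ outside a family of $q$-modulus zero. The Dirichlet space $D^{1,q}(X)$ consists of the $\mu$-measurable functions $u\colon X\to\mathbb R$ that have a $q$-weak upper gradient in $L^q(X,\mu)$. For $u\in D^{1,q}(X)$, $|\nabla_q u|$ denotes the minimal $q$-weak upper gradient of $u$, which is the one that is $\mu$-a.e. at most every $q$-integrable $q$-weak upper gradient of $u$. Let $\varphi\colon X\to Y$ be a $\mu$-measurable mapping that induces a bounded composition operator $\varphi^*\colon \operatorname{Lip}(Y)\to D^{1,q}(X)$, $\varphi^*u=u\circ\varphi$. That is, $u\circ\varphi\in D^{1,q}(X)$ for every Lipschitz function $u\colon Y\to\mathbb R$, and there is a constant $C<\infty$ such that $$\Bigl(\int_X|\nabla_q(u\circ\varphi)|^q\,d\mu\Bigr)^{1/q}\le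 C\operatorname{Lip}(u)\qquad\text{for all Lipschitz } u\colon Y\to\mathbb R,$$ where $\operatorname{Lip}(u)$ is the least Lipschitz constant of $u$. For Borel sets $B\subset Y$ put $$\Psi(B)=\sup\Bigl\{\int_{\varphi^{-1}(B)}|\nabla_q(u\circ\varphi)|^q\,d\mu \;:\; u\colon Y\to\mathbb R,\ \operatorname{Lip}(u)\le 1\Bigr\}.$$ Then $\Psi$ extends to a finite regular Borel measure $\widetilde\Psi$ on $Y$ by the formula $$\widetilde\Psi(A)=\inf\{\Psi(B) : A\subset B,\ B\text{ Borel}\},\qquad A\subset Y.$$ That is, $\widetilde\Psi$ is an outer measure on $Y$ for which all Borel sets are measurable, $\widetilde\Psi(B)=\Psi(B)$ for every Borel set $B$, $\widetilde\Psi(Y)<\infty$, and every $A\subset Y$ is contained in a Borel set $B$ with $\widetilde\Psi(B)=\widetilde\Psi(A)$. -/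

import Mathlib

open MeasureTheory Set
open scoped ENNReal NNReal

/-- The standing assumption on a metric measure space (besides separability and the Borel
`σ`-algebra): the measure is nontrivial and finite on bounded sets.  Borel regularity is built into
`Measure` on the Borel `σ`-algebra, as an arbitrary set gets the infimum of the measures of its Borel
supersets. -/
structure IsMetricMeasure {X : Type*} [MetricSpace X] [MeasurableSpace X]
    (μ : Measure X) : Prop where
  ne_zero : μ ≠ 0
  lt_top_of_isBounded : ∀ s : Set X, Bornology.IsBounded s → μ s < ∞

/-- A compact nonconstant rectifiable curve, parametrized by arc length on `[a, b]`.  (The values of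
`toFun` off `[a, b]` play no role.)  Length, line integrals and moduli of general rectifiable curves
are by definition those of their arc length parametrizations. -/
structure RectCurve (X : Type*) [MetricSpace X] where
  a : ℝ
  b : ℝ
  lt : a < b
  toFun : ℝ → X
  unitSpeed : HasUnitSpeedOn toFun (Icc a b)

/-- The line integral `∫_γ ρ ds`. -/
noncomputable def RectCurve.lineIntegral {X : Type*} [MetricSpace X]
    (γ : RectCurve X) (ρ : X → ℝ≥0∞) : ℝ≥0∞ :=
  ∫⁻ t in Icc γ.a γ.b, ρ (γ.toFun t)

/-- The `q`-modulus of a family of curves. -/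
noncomputable def curveModulus {X : Type*} [MetricSpace X] [MeasurableSpace X]
    (μ : Measure X) (q : ℝ) (Γ : Set (RectCurve X)) : ℝ≥0∞ :=
  ⨅ (ρ : X → ℝ≥0∞) (_ : Measurable ρ) (_ : ∀ γ ∈ Γ, 1 ≤ γ.lineIntegral ρ), ∫⁻ x, ρ x ^ q ∂μ

/-- `g` is a `q`-weak upper gradient of `u`: it is a Borel function, and
`|u(γ(a)) - u(γ(b))| ≤ ∫_γ g ds` for all curves outside a family of `q`-modulus zero. -/
def IsWeakUpperGradient {X : Type*} [MetricSpace X] [MeasurableSpace X]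
    (μ : Measure X) (q : ℝ) (u : X → ℝ) (g : X → ℝ≥0∞) : Prop :=
  Measurable g ∧
    curveModulus μ q
      {γ : RectCurve X |
        ¬ edist (u (γ.toFun γ.a)) (u (γ.toFun γ.b)) ≤ γ.lineIntegral g} = 0

/-- `g` is a `q`-integrable `q`-weak upper gradient of `u`. -/
def IsIntegrableWeakUpperGradient {X : Type*} [MetricSpace X] [MeasurableSpace X]
    (μ : Measure X) (q : ℝ) (u : X → ℝ) (g : X → ℝ≥0∞) : Prop :=
  IsWeakUpperGradient μ q u g ∧ ∫⁻ x, g x ^ q ∂μ < ∞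

/-- Membership in the Dirichlet (homogeneous Sobolev) space `D^{1,q}(X)`: `u` is `μ`-measurable and
has a `q`-integrable `q`-weak upper gradient. -/
def MemDirichlet {X : Type*} [MetricSpace X] [MeasurableSpace X]
    (μ : Measure X) (q : ℝ) (u : X → ℝ) : Prop :=
  AEMeasurable u μ ∧ ∃ g : X → ℝ≥0∞, IsIntegrableWeakUpperGradient μ q u g

/-- `g` is a minimal `q`-weak upper gradient of `u`. -/
def IsMinimalWeakUpperGradient {X : Type*} [MetricSpace X] [MeasurableSpace X]
    (μ : Measure X) (q : ℝ) (u : X → ℝ) (g : X → ℝ≥0∞) : Prop :=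
  IsIntegrableWeakUpperGradient μ q u g ∧
    ∀ h : X → ℝ≥0∞, IsIntegrableWeakUpperGradient μ q u h → g ≤ᵐ[μ] h

open Classical in
/-- `|∇_q u|`, the minimal `q`-weak upper gradient of `u ∈ D^{1,q}(X)` (a representative of it, as it
is unique up to `μ`-null sets).  The value for `u ∉ D^{1,q}(X)` is never used. -/
noncomputable def minGrad {X : Type*} [MetricSpace X] [MeasurableSpace X]
    (μ : Measure X) (q : ℝ) (u : X → ℝ) : X → ℝ≥0∞ :=
  if h : ∃ g : X → ℝ≥0∞, IsMinimalWeakUpperGradient μ q u g then h.choose else 0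

/-- `φ` induces a bounded composition operator `φ^* : Lip(Y) → D^{1,q}(X)`, `u ↦ u ∘ φ`: there is a
constant `C` with `‖|∇_q (u ∘ φ)|‖_{L^q(X)} ≤ C Lip(u)` for all Lipschitz `u`. -/
def InducesBoundedCompLip {X Y : Type*} [MetricSpace X] [MeasurableSpace X] [MetricSpace Y]
    (μ : Measure X) (q : ℝ) (φ : X → Y) : Prop :=
  ∃ C : ℝ≥0, ∀ (u : Y → ℝ) (K : ℝ≥0), LipschitzWith K u →
    MemDirichlet μ q (u ∘ φ) ∧
      (∫⁻ x, minGrad μ q (u ∘ φ) x ^ q ∂μ) ^ (1 / q) ≤ (C : ℝ≥0∞) * (K : ℝ≥0∞)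

/-- `Ψ(B) = sup ∫_{φ⁻¹(B)} |∇_q (u ∘ φ)|^q dμ` over the functions `u` on `Y` with `Lip(u) ≤ 1`. -/
noncomputable def compSetFun {X Y : Type*} [MetricSpace X] [MeasurableSpace X] [MetricSpace Y]
    (μ : Measure X) (q : ℝ) (φ : X → Y) (B : Set Y) : ℝ≥0∞ :=
  ⨆ (u : Y → ℝ) (_ : LipschitzWith 1 u), ∫⁻ x in φ ⁻¹' B, minGrad μ q (u ∘ φ) x ^ q ∂μ

/-! For each 1-Lipschitz `u`, the integral of |∇_q(u∘φ)|^q over φ⁻¹(B) is a finite measure in B, and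
Ψ is the supremum of these measures. A supremum of measures is countably subadditive, so the point
is superadditivity on disjoint Borel sets (`compSetFun_add_le_union`): two competitors u₁, u₂ must
be merged into a single 1-Lipschitz function without losing energy.

Inner regularity reduces to closed sets, and then to sets F₁, F₂ at distance at least r > 0. There
uᵢ is replaced by its distance to rℤ. This sawtooth is still 1-Lipschitz but at most r/2, so it can
be cut off to zero before reaching the other set, and the two pieces glue
(`exists_lipschitzWith_one_gluing`). No energy is lost: at each point u = rn ± w for some integer n,
and the minimal gradient is local and invariant under isometries of ℝ
(`minGrad_le_of_eq_isometry_comp`).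

Locality rests on `IsIntegrableWeakUpperGradient.piecewise`: where two functions agree, their upper
gradients may be exchanged. Along a curve this is a one-dimensional statement about increments
bounded by atomless measures. The same gluing yields minima of upper gradients, hence the existence
of a minimal one. -/

/-! ### Increments of functions on an interval -/

/-- Subadditivity along chains: an estimate on the increments of `f` by a measure without atoms
that holds on the members of a two-set open cover of `[a, b]` holds on `[a, b]`. -/
theorem edist_le_measure_Icc_of_local {f : ℝ → ℝ} {a b : ℝ} (hab : a ≤ b)
    {τ : Measure ℝ} [NullSingletonClass τ] {U V : Set ℝ} (hU : IsOpen U) (hV : IsOpen V)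
    (hUV : U ∪ V = univ)
    (h : ∀ s t, a ≤ s → s ≤ t → t ≤ b → (Icc s t ⊆ U ∨ Icc s t ⊆ V) →
      edist (f s) (f t) ≤ τ (Icc s t)) :
    edist (f a) (f b) ≤ τ (Icc a b) := by
  obtain ⟨t, ht0, hmono, ⟨m, hm⟩, hsub⟩ := exists_monotone_Icc_subset_open_cover_Icc hab
    (c := fun i : Bool => ((↑) : Icc a b → ℝ) ⁻¹' (if i then U else V))
    (fun i => by cases i <;> simp [hU.preimage continuous_subtype_val,
      hV.preimage continuous_subtype_val])
    (fun x _ => by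
      have : (x : ℝ) ∈ U ∪ V := hUV ▸ mem_univ _
      rcases this with hx | hx
      · exact mem_iUnion.2 ⟨true, by simpa using hx⟩
      · exact mem_iUnion.2 ⟨false, by simpa using hx⟩)
  have key : ∀ n, edist (f a) (f (t n)) ≤ τ (Icc a (t n)) := by
    intro n
    induction n with
    | zero => simp [ht0]
    | succ n ih =>
      have hle : (t n : ℝ) ≤ t (n + 1) := hmono n.le_succ
      have hstep : edist (f (t n)) (f (t (n + 1))) ≤ τ (Icc (t n : ℝ) (t (n + 1))) := by
        refine h _ _ (t n).2.1 hle (t (n + 1)).2.2 ?_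
        obtain ⟨i, hi⟩ := hsub n
        have : ∀ x ∈ Icc (t n : ℝ) (t (n + 1)), x ∈ (if i then U else V) := fun x hx =>
          hi (show (⟨x, (t n).2.1.trans hx.1, hx.2.trans (t (n + 1)).2.2⟩ : Icc a b) ∈
            Icc (t n) (t (n + 1)) from ⟨hx.1, hx.2⟩)
        cases i
        · exact Or.inr fun x hx => by simpa using this x hx
        · exact Or.inl fun x hx => by simpa using this x hx
      calc edist (f a) (f (t (n + 1)))
          ≤ τ (Icc a (t n)) + τ (Icc (t n : ℝ) (t (n + 1))) :=
            (edist_triangle _ _ _).trans (add_le_add ih hstep)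
        -- Without atoms, closed intervals may be made half-open, hence disjoint, so that their
        -- measures add.
        _ = τ (Ioc a (t n)) + τ (Ioc (t n : ℝ) (t (n + 1))) := by
            rw [measure_congr Ioc_ae_eq_Icc, measure_congr Ioc_ae_eq_Icc]
        _ = τ (Ioc a (t (n + 1))) := by
            rw [← measure_union _ measurableSet_Ioc, Ioc_union_Ioc_eq_Ioc (t n).2.1 hle]
            exact Ioc_disjoint_Ioc_of_le le_rfl
        _ = τ (Icc a (t (n + 1))) := measure_congr Ioc_ae_eq_Icc
  simpa [hm m le_rfl] using key m

/-- If `f` and `k` agree on the closed set `K` and `U` is an open neighbourhood of `K`, then an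
estimate for the increments of `k` may be used on `U`, and one for those of `f` is only needed
off `K`. -/
theorem edist_le_of_eqOn_isClosed {f k : ℝ → ℝ} {a b : ℝ} (hab : a ≤ b) {α β : Measure ℝ}
    [NullSingletonClass α] [NullSingletonClass β]
    (hf : ∀ s t, a ≤ s → s ≤ t → t ≤ b → edist (f s) (f t) ≤ α (Icc s t))
    (hk : ∀ s t, a ≤ s → s ≤ t → t ≤ b → edist (k s) (k t) ≤ β (Icc s t))
    {K U : Set ℝ} (hK : IsClosed K) (hU : IsOpen U) (hKU : K ⊆ U)
    (hfk : ∀ t ∈ K, a ≤ t → t ≤ b → f t = k t) :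
    edist (f a) (f b) ≤ α (Icc a b ∩ Kᶜ) + β (Icc a b ∩ U) := by
  set τ : Measure ℝ := α.restrict Kᶜ + β.restrict U with hτ
  have hαle : ∀ s, MeasurableSet s → s ⊆ Kᶜ → α s ≤ τ s := fun s hs hsK => by
    rw [hτ, Measure.add_apply, Measure.restrict_apply hs, inter_eq_left.2 hsK]
    exact le_self_add
  have hβle : ∀ s, MeasurableSet s → s ⊆ U → β s ≤ τ s := fun s hs hsU => by
    rw [hτ, Measure.add_apply,
      Measure.restrict_apply (μ := β) hs, inter_eq_left.2 hsU]
    exact le_add_self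
  have hatoms : NullSingletonClass τ := ⟨fun x => by
    rw [hτ, Measure.add_apply, measure_singleton, measure_singleton, add_zero]⟩
  have main : edist (f a) (f b) ≤ τ (Icc a b) := by
    refine edist_le_measure_Icc_of_local hab hU hK.isOpen_compl ?_ ?_
    · exact univ_subset_iff.1 fun x _ => (em (x ∈ K)).imp (fun h => hKU h) id
    intro s t has hst htb hcover
    by_cases hne : (Icc s t ∩ K).Nonempty
    · have hsub : Icc s t ⊆ U := hcover.resolve_right fun h => by
        obtain ⟨x, hx, hxK⟩ := hne
        exact h hx hxK
      -- Split at the first point p and the last point r of K in [s, t]. The outer pieces avoid K up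
      -- to an endpoint, and between p and r the increments of f and k coincide.
      have hcomp : IsCompact (Icc s t ∩ K) := isCompact_Icc.inter_right hK
      obtain ⟨p, ⟨hp, hpK⟩, hpmin⟩ := hcomp.exists_isLeast hne
      obtain ⟨r, ⟨hr, hrK⟩, hrmax⟩ := hcomp.exists_isGreatest hne
      have hpr : p ≤ r := hpmin ⟨hr, hrK⟩
      have h1 : edist (f s) (f p) ≤ τ (Ico s p) := by
        refine (hf s p has hp.1 (hp.2.trans htb)).trans ?_
        rw [← measure_congr Ico_ae_eq_Icc]
        refine hαle _ measurableSet_Ico fun x hx hxK => ?_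
        exact absurd (hpmin ⟨⟨hx.1, hx.2.le.trans hp.2⟩, hxK⟩) (not_le.2 hx.2)
      have h2 : edist (f p) (f r) ≤ τ (Icc p r) := by
        rw [hfk p hpK (has.trans hp.1) (hp.2.trans htb),
          hfk r hrK (has.trans hr.1) (hr.2.trans htb)]
        refine (hk p r (has.trans hp.1) hpr (hr.2.trans htb)).trans ?_
        exact hβle _ measurableSet_Icc ((Icc_subset_Icc hp.1 hr.2).trans hsub)
      have h3 : edist (f r) (f t) ≤ τ (Ioc r t) := by
        refine (hf r t (has.trans hr.1) hr.2 htb).trans ?_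
        rw [← measure_congr Ioc_ae_eq_Icc]
        refine hαle _ measurableSet_Ioc fun x hx hxK => ?_
        exact absurd (hrmax ⟨⟨hr.1.trans hx.1.le, hx.2⟩, hxK⟩) (not_le.2 hx.1)
      calc edist (f s) (f t) ≤ edist (f s) (f p) + edist (f p) (f r) + edist (f r) (f t) :=
            edist_triangle4 _ _ _ _
        _ ≤ τ (Ico s p) + τ (Icc p r) + τ (Ioc r t) := by gcongr
        _ = τ (Icc s t) := by
            rw [← measure_union _ measurableSet_Icc, Ico_union_Icc_eq_Icc hp.1 hpr,
              ← measure_union _ measurableSet_Ioc, Icc_union_Ioc_eq_Icc hr.1 hr.2]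
            · exact disjoint_left.2 fun x hx hx' => absurd hx.2 (not_le.2 hx'.1)
            · exact disjoint_left.2 fun x hx hx' => absurd hx.2 (not_lt.2 hx'.1)
    · refine (hf s t has hst htb).trans (hαle _ measurableSet_Icc fun x hx hxK => hne ⟨x, hx, hxK⟩)
  rwa [hτ, Measure.add_apply, Measure.restrict_apply measurableSet_Icc,
    Measure.restrict_apply measurableSet_Icc] at main

/-- The estimate for the increments of `k` may be used on a measurable set on which `f = k`. -/
theorem edist_le_of_eqOn_measurableSet {f k : ℝ → ℝ} {a b : ℝ} (hab : a ≤ b) {α β : Measure ℝ}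
    [IsFiniteMeasure α] [IsFiniteMeasure β] [NullSingletonClass α] [NullSingletonClass β]
    (hf : ∀ s t, a ≤ s → s ≤ t → t ≤ b → edist (f s) (f t) ≤ α (Icc s t))
    (hk : ∀ s t, a ≤ s → s ≤ t → t ≤ b → edist (k s) (k t) ≤ β (Icc s t))
    {Z : Set ℝ} (hZ : MeasurableSet Z) (hfk : ∀ t ∈ Z, a ≤ t → t ≤ b → f t = k t) :
    edist (f a) (f b) ≤ α Zᶜ + β Z := by
  refine ENNReal.le_of_forall_pos_le_add fun ε hε _ => ?_
  have hε2 : (ε / 2 : ℝ≥0∞) ≠ 0 := by simp [hε.ne']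
  -- Z is approximated from inside for α and from outside for β.
  obtain ⟨K, hKZ, hK, hαK⟩ := hZ.exists_isClosed_sdiff_lt (measure_ne_top α Z) hε2
  obtain ⟨U, hZU, hU, hβU⟩ := Z.exists_isOpen_le_add β hε2
  calc edist (f a) (f b) ≤ α (Icc a b ∩ Kᶜ) + β (Icc a b ∩ U) :=
        edist_le_of_eqOn_isClosed hab hf hk hK hU (hKZ.trans hZU) fun t ht => hfk t (hKZ ht)
    _ ≤ (α Zᶜ + α (Z \ K)) + β U := by
        gcongr
        · refine (measure_mono fun x hx => ?_).trans (measure_union_le _ _)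
          exact (em (x ∈ Z)).symm.imp id fun h => ⟨h, hx.2⟩
        · exact inter_subset_right
    _ ≤ (α Zᶜ + ε / 2) + (β Z + ε / 2) := by gcongr
    _ = α Zᶜ + β Z + ε := by
        rw [add_add_add_comm, ENNReal.add_halves]

/-! ### Integrals of q-th powers -/

section Lintegral

variable {X : Type*} [MeasurableSpace X] {μ : Measure X} {q : ℝ}

/-- The q-th power of a supremum is the supremum of the q-th powers, hence at most their sum.
Combining densities by suprema thus avoids the triangle inequality in L^q. -/
theorem lintegral_iSup_rpow_le (hq : 0 < q) {ρ : ℕ → X → ℝ≥0∞} (hρ : ∀ n, Measurable (ρ n)) :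
    ∫⁻ x, (⨆ n, ρ n x) ^ q ∂μ ≤ ∑' n, ∫⁻ x, ρ n x ^ q ∂μ := by
  rw [← lintegral_tsum fun n => ((hρ n).pow_const q).aemeasurable]
  refine lintegral_mono fun x => ?_
  rw [← ENNReal.le_rpow_inv_iff hq]
  refine iSup_le fun n => ?_
  rw [ENNReal.le_rpow_inv_iff hq]
  exact ENNReal.le_tsum n

theorem lintegral_const_mul_rpow (hq : 0 < q) {ρ : X → ℝ≥0∞} (hρ : Measurable ρ) (c : ℝ≥0∞) :
    ∫⁻ x, (c * ρ x) ^ q ∂μ = c ^ q * ∫⁻ x, ρ x ^ q ∂μ := by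
  simp_rw [ENNReal.mul_rpow_of_nonneg _ _ hq.le]
  exact lintegral_const_mul _ (hρ.pow_const q)

end Lintegral

/-! ### Subcurves and line integrals -/

namespace RectCurve

variable {X : Type*} [MetricSpace X]

/-- The restriction of a curve to a nondegenerate subinterval. -/
def subcurve (γ : RectCurve X) (s t : ℝ) (hs : γ.a ≤ s) (hst : s < t) (ht : t ≤ γ.b) :
    RectCurve X where
  a := s
  b := t
  lt := hst
  toFun := γ.toFun
  unitSpeed := by
    intro x hx y hy
    have h := γ.unitSpeed (x := x) ⟨hs.trans hx.1, hx.2.trans ht⟩ (y := y)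
      ⟨hs.trans hy.1, hy.2.trans ht⟩
    rw [← h, inter_eq_right.2 (Icc_subset_Icc hx.1 hy.2),
      inter_eq_right.2 (Icc_subset_Icc (hs.trans hx.1) (hy.2.trans ht))]

theorem lineIntegral_subcurve_le (γ : RectCurve X) {s t : ℝ} (hs : γ.a ≤ s) (hst : s < t)
    (ht : t ≤ γ.b) (ρ : X → ℝ≥0∞) :
    (γ.subcurve s t hs hst ht).lineIntegral ρ ≤ γ.lineIntegral ρ :=
  lintegral_mono_set (Icc_subset_Icc hs ht)

theorem lineIntegral_mono (γ : RectCurve X) {ρ σ : X → ℝ≥0∞} (h : ρ ≤ σ) :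
    γ.lineIntegral ρ ≤ γ.lineIntegral σ :=
  lintegral_mono fun t => h (γ.toFun t)

theorem const_mul_lineIntegral_le (γ : RectCurve X) (c : ℝ≥0∞) (ρ : X → ℝ≥0∞) :
    c * γ.lineIntegral ρ ≤ γ.lineIntegral fun x => c * ρ x :=
  lintegral_const_mul_le _ _

theorem continuousOn (γ : RectCurve X) : ContinuousOn γ.toFun (Icc γ.a γ.b) := by
  have hord : ∀ x ∈ Icc γ.a γ.b, ∀ y ∈ Icc γ.a γ.b, x ≤ y →
      edist (γ.toFun x) (γ.toFun y) ≤ edist x y := by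
    intro x hx y hy hxy
    refine (eVariationOn.edist_le γ.toFun (s := Icc γ.a γ.b ∩ Icc x y)
      ⟨hx, le_rfl, hxy⟩ ⟨hy, hxy, le_rfl⟩).trans ?_
    rw [γ.unitSpeed hx hy, NNReal.coe_one, one_mul, edist_comm, edist_dist, Real.dist_eq,
      abs_of_nonneg (sub_nonneg.2 hxy)]
  have : LipschitzOnWith 1 γ.toFun (Icc γ.a γ.b) := by
    intro x hx y hy
    rw [ENNReal.coe_one, one_mul]
    rcases le_total x y with h | h
    · exact hord x hx y hy h
    · rw [edist_comm, edist_comm x]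
      exact hord y hy x hx h
  exact this.continuousOn

/-- The extension of the curve to `ℝ` that is constant on both sides of the interval. -/
noncomputable def extend (γ : RectCurve X) (t : ℝ) : X := γ.toFun (projIcc γ.a γ.b γ.lt.le t)

theorem continuous_extend (γ : RectCurve X) : Continuous γ.extend :=
  (continuousOn_iff_continuous_domRestrict.1 γ.continuousOn).comp continuous_projIcc

theorem extend_eq (γ : RectCurve X) {t : ℝ} (ht : t ∈ Icc γ.a γ.b) :
    γ.extend t = γ.toFun t := by
  rw [extend, projIcc_of_mem _ ht]

theorem lineIntegral_eq_extend (γ : RectCurve X) (ρ : X → ℝ≥0∞) :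
    γ.lineIntegral ρ = ∫⁻ t in Icc γ.a γ.b, ρ (γ.extend t) :=
  setLIntegral_congr_fun measurableSet_Icc fun t ht => by rw [γ.extend_eq ht]

end RectCurve

/-! ### Curve families of modulus zero -/

section Modulus

variable {X : Type*} [MetricSpace X] [MeasurableSpace X] {μ : Measure X} {q : ℝ}

/-- A curve family has zero modulus iff all its members have infinite length with respect to a
common `q`-integrable density. -/
theorem curveModulus_eq_zero_iff (hq : 0 < q) {Γ : Set (RectCurve X)} :
    curveModulus μ q Γ = 0 ↔ ∃ ρ : X → ℝ≥0∞, Measurable ρ ∧ ∫⁻ x, ρ x ^ q ∂μ ≠ ∞ ∧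
      ∀ γ ∈ Γ, γ.lineIntegral ρ = ∞ := by
  constructor
  · intro h
    -- The bound makes the energy of `n * ρ n` at most 2⁻ⁿ, while its line integrals are at least n.
    -- For n = 0 the bound is ∞.
    have hex : ∀ n : ℕ, ∃ ρ : X → ℝ≥0∞, Measurable ρ ∧ (∀ γ ∈ Γ, 1 ≤ γ.lineIntegral ρ) ∧
        ∫⁻ x, ρ x ^ q ∂μ < (2⁻¹ : ℝ≥0∞) ^ n * (((n : ℝ≥0∞) ^ q)⁻¹) := by
      intro n
      have hpos : 0 < (2⁻¹ : ℝ≥0∞) ^ n * (((n : ℝ≥0∞) ^ q)⁻¹) :=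
        ENNReal.mul_pos (pow_ne_zero _ (by simp))
          (ENNReal.inv_ne_zero.2 (ENNReal.rpow_ne_top_of_nonneg hq.le (by simp)))
      rw [← h, curveModulus] at hpos
      simp only [iInf_lt_iff] at hpos
      obtain ⟨ρ, h1, h2, h3⟩ := hpos
      exact ⟨ρ, h1, h2, h3⟩
    choose ρ hm hone hint using hex
    refine ⟨fun x => ⨆ n : ℕ, (n : ℝ≥0∞) * ρ n x, Measurable.iSup fun n => (hm n).const_mul _, ?_, ?_⟩
    · refine ne_top_of_le_ne_top (b := ∑' n : ℕ, (2⁻¹ : ℝ≥0∞) ^ n) ?_ ?_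
      · rw [ENNReal.tsum_geometric]
        simp
      refine (lintegral_iSup_rpow_le hq fun n => (hm n).const_mul _).trans ?_
      refine ENNReal.tsum_le_tsum fun n => ?_
      rw [lintegral_const_mul_rpow hq (hm n)]
      calc (n : ℝ≥0∞) ^ q * ∫⁻ x, ρ n x ^ q ∂μ
          ≤ (n : ℝ≥0∞) ^ q * ((2⁻¹ : ℝ≥0∞) ^ n * (((n : ℝ≥0∞) ^ q)⁻¹)) := by
            gcongr
            exact (hint n).le
        _ = (2⁻¹ : ℝ≥0∞) ^ n * ((n : ℝ≥0∞) ^ q * ((n : ℝ≥0∞) ^ q)⁻¹) := by ring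
        _ ≤ (2⁻¹ : ℝ≥0∞) ^ n := mul_le_of_le_one_right' (ENNReal.mul_inv_le_one _)
    · intro γ hγ
      refine ENNReal.eq_top_of_forall_nnreal_le fun r => ?_
      obtain ⟨n, hn⟩ := exists_nat_ge r
      calc (r : ℝ≥0∞) ≤ n := by exact_mod_cast hn
        _ ≤ n * γ.lineIntegral (ρ n) := le_mul_of_one_le_right' (hone n γ hγ)
        _ ≤ γ.lineIntegral fun x => n * ρ n x := γ.const_mul_lineIntegral_le _ _
        _ ≤ _ := γ.lineIntegral_mono fun x => le_iSup (fun n : ℕ => (n : ℝ≥0∞) * ρ n x) n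
  · rintro ⟨ρ, hm, hint, htop⟩
    refine le_antisymm (ENNReal.le_of_forall_pos_le_add fun ε hε _ => ?_) zero_le
    set I := ∫⁻ x, ρ x ^ q ∂μ with hI
    -- Scaling by c brings the energy below ε; adding 1 to I avoids division by zero.
    set c : ℝ≥0∞ := (ε / (I + 1)) ^ q⁻¹ with hc
    have hcq : c ^ q = ε / (I + 1) := by rw [hc, ENNReal.rpow_inv_rpow hq.ne']
    have hc0 : c ≠ 0 := by
      intro h0
      rw [h0, ENNReal.zero_rpow_of_pos hq, eq_comm, ENNReal.div_eq_zero_iff] at hcq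
      rcases hcq with h | h
      · exact hε.ne' (by exact_mod_cast h)
      · exact ENNReal.add_ne_top.2 ⟨hint, ENNReal.one_ne_top⟩ h
    rw [zero_add, curveModulus]
    refine (iInf₂_le_of_le (fun x => c * ρ x) (hm.const_mul c) <|
      iInf_le_of_le ?_ le_rfl).trans ?_
    · intro γ hγ
      refine le_trans ?_ (γ.const_mul_lineIntegral_le c ρ)
      rw [htop γ hγ, ENNReal.mul_top hc0]
      exact le_top
    · rw [lintegral_const_mul_rpow hq hm, hcq, ← hI]
      calc (ε : ℝ≥0∞) / (I + 1) * I ≤ ε / (I + 1) * (I + 1) := by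
            gcongr
            exact le_self_add
        _ ≤ ε := ENNReal.mul_le_of_le_div le_rfl

/-- A sequence of `q`-integrable densities can be controlled by a single one. -/
theorem exists_common_density (hq : 0 < q) {ρ : ℕ → X → ℝ≥0∞} (hρ : ∀ n, Measurable (ρ n))
    (hint : ∀ n, ∫⁻ x, ρ n x ^ q ∂μ ≠ ∞) :
    ∃ σ : X → ℝ≥0∞, Measurable σ ∧ ∫⁻ x, σ x ^ q ∂μ ≠ ∞ ∧
      ∀ γ : RectCurve X, γ.lineIntegral σ ≠ ∞ → ∀ n, γ.lineIntegral (ρ n) ≠ ∞ := by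
  -- The factors make the energies summable; being nonzero, they keep infinite line integrals
  -- infinite.
  have hc : ∀ n : ℕ, ∃ c : ℝ≥0∞, c ≠ 0 ∧ c ^ q * ∫⁻ x, ρ n x ^ q ∂μ ≤ 2⁻¹ ^ n := by
    intro n
    set I := ∫⁻ x, ρ n x ^ q ∂μ with hI
    refine ⟨(2⁻¹ ^ n / (I + 1)) ^ q⁻¹, ?_, ?_⟩
    · intro h0
      rw [ENNReal.rpow_eq_zero_iff_of_pos (inv_pos.2 hq), ENNReal.div_eq_zero_iff] at h0
      rcases h0 with h | h
      · exact pow_ne_zero n (by simp) h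
      · exact ENNReal.add_ne_top.2 ⟨hint n, ENNReal.one_ne_top⟩ h
    · rw [ENNReal.rpow_inv_rpow hq.ne']
      calc (2⁻¹ : ℝ≥0∞) ^ n / (I + 1) * I ≤ 2⁻¹ ^ n / (I + 1) * (I + 1) := by
            gcongr
            exact le_self_add
        _ ≤ 2⁻¹ ^ n := ENNReal.mul_le_of_le_div le_rfl
  choose c hc0 hcI using hc
  refine ⟨fun x => ⨆ n, c n * ρ n x, Measurable.iSup fun n => (hρ n).const_mul _, ?_, ?_⟩
  · refine ne_top_of_le_ne_top (b := ∑' n : ℕ, (2⁻¹ : ℝ≥0∞) ^ n) ?_ ?_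
    · rw [ENNReal.tsum_geometric]
      simp
    refine (lintegral_iSup_rpow_le hq fun n => (hρ n).const_mul _).trans ?_
    refine ENNReal.tsum_le_tsum fun n => ?_
    rw [lintegral_const_mul_rpow hq (hρ n)]
    exact hcI n
  · intro γ hγ n htop
    refine hγ (top_unique ?_)
    calc ∞ = c n * γ.lineIntegral (ρ n) := by rw [htop, ENNReal.mul_top (hc0 n)]
      _ ≤ γ.lineIntegral fun x => c n * ρ n x := γ.const_mul_lineIntegral_le _ _
      _ ≤ _ := γ.lineIntegral_mono fun x => le_iSup (fun n : ℕ => c n * ρ n x) n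

/-- Exceptional families become sets of curves with infinite integral of one density, so countably
many of them can be merged by `exists_common_density`. -/
theorem isWeakUpperGradient_iff (hq : 0 < q) {u : X → ℝ} {g : X → ℝ≥0∞} :
    IsWeakUpperGradient μ q u g ↔ Measurable g ∧
      ∃ ρ : X → ℝ≥0∞, Measurable ρ ∧ ∫⁻ x, ρ x ^ q ∂μ ≠ ∞ ∧
        ∀ γ : RectCurve X, γ.lineIntegral ρ ≠ ∞ →
          edist (u (γ.toFun γ.a)) (u (γ.toFun γ.b)) ≤ γ.lineIntegral g := by
  rw [IsWeakUpperGradient, curveModulus_eq_zero_iff hq]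
  refine and_congr_right fun _ => exists_congr fun ρ => and_congr_right fun _ =>
    and_congr_right fun _ => forall_congr' fun γ => ?_
  rw [mem_ofPred_eq, not_imp_comm]

end Modulus

/-! ### Gluing, minimality and locality of weak upper gradients -/

section Gluing

variable {X : Type*} [MetricSpace X] [MeasurableSpace X] {μ : Measure X} {q : ℝ}

/-- For a `q`-integrable weak upper gradient, the defining inequality holds along all subcurves of
almost every curve, and the line integrals are finite. -/
theorem IsIntegrableWeakUpperGradient.exists_density (hq : 0 < q) {u : X → ℝ} {g : X → ℝ≥0∞}
    (hg : IsIntegrableWeakUpperGradient μ q u g) :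
    ∃ ρ : X → ℝ≥0∞, Measurable ρ ∧ ∫⁻ x, ρ x ^ q ∂μ ≠ ∞ ∧
      ∀ γ : RectCurve X, γ.lineIntegral ρ ≠ ∞ → γ.lineIntegral g ≠ ∞ ∧
        ∀ s t, γ.a ≤ s → s ≤ t → t ≤ γ.b →
          edist (u (γ.toFun s)) (u (γ.toFun t)) ≤ ∫⁻ r in Icc s t, g (γ.toFun r) := by
  obtain ⟨hgm, ρ, hρ, hρq, h⟩ := (isWeakUpperGradient_iff hq).1 hg.1
  -- Index 0 carries the exceptional density, all others carry g itself, which makes the line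
  -- integral of g finite.
  obtain ⟨σ, hσ, hσq, hσ'⟩ := exists_common_density (μ := μ) hq
    (ρ := fun n => if n = 0 then ρ else g) (fun n => by split_ifs <;> assumption)
    (fun n => by
      split_ifs
      exacts [hρq, hg.2.ne])
  refine ⟨σ, hσ, hσq, fun γ hγ => ⟨by simpa using hσ' γ hγ 1, fun s t hs hst ht => ?_⟩⟩
  rcases hst.eq_or_lt with rfl | hst
  · simp
  · refine h (γ.subcurve s t hs hst ht) (ne_top_of_le_ne_top ?_
      (γ.lineIntegral_subcurve_le hs hst ht ρ))
    simpa using hσ' γ hγ 0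

open Classical in
/-- If `u = v` on the Borel set `E`, then a weak upper gradient of `u` may be replaced on `E` by a
weak upper gradient of `v`. -/
theorem IsIntegrableWeakUpperGradient.piecewise [BorelSpace X] (hq : 0 < q) {u v : X → ℝ}
    {g h : X → ℝ≥0∞} (hg : IsIntegrableWeakUpperGradient μ q u g)
    (hh : IsIntegrableWeakUpperGradient μ q v h) {E : Set X} (hE : MeasurableSet E)
    (huv : ∀ x ∈ E, u x = v x) :
    IsIntegrableWeakUpperGradient μ q u (E.piecewise h g) := by
  have hgm := hg.1.1
  have hhm := hh.1.1
  obtain ⟨ρ, hρ, hρq, hρ'⟩ := hg.exists_density hq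
  obtain ⟨σ, hσ, hσq, hσ'⟩ := hh.exists_density hq
  obtain ⟨τ, hτ, hτq, hτ'⟩ := exists_common_density (μ := μ) hq
    (ρ := fun n => if n = 0 then ρ else σ) (fun n => by split_ifs <;> assumption)
    (fun n => by split_ifs <;> assumption)
  refine ⟨(isWeakUpperGradient_iff hq).2 ⟨hhm.piecewise hE hgm, τ, hτ, hτq, fun γ hγ => ?_⟩, ?_⟩
  · obtain ⟨hgfin, hgle⟩ := hρ' γ (by simpa using hτ' γ hγ 0)
    obtain ⟨hhfin, hhle⟩ := hσ' γ (by simpa using hτ' γ hγ 1)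
    -- The extended curve is continuous on all of ℝ, so the times spent in E form a Borel set, to
    -- which the one-dimensional estimate applies.
    have hcont := γ.continuous_extend.measurable
    set lam : Measure ℝ := volume.restrict (Icc γ.a γ.b) with hlam
    have hfin : ∀ k : X → ℝ≥0∞, γ.lineIntegral k ≠ ∞ →
        IsFiniteMeasure (lam.withDensity fun t => k (γ.extend t)) := fun k hk =>
      isFiniteMeasure_withDensity (by rwa [γ.lineIntegral_eq_extend] at hk)
    have := hfin g hgfin
    have := hfin h hhfin
    have happ : ∀ (k : X → ℝ≥0∞) (s t : ℝ), γ.a ≤ s → t ≤ γ.b →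
        (lam.withDensity fun r => k (γ.extend r)) (Icc s t) = ∫⁻ r in Icc s t, k (γ.toFun r) := by
      intro k s t hs ht
      have hsub : Icc s t ⊆ Icc γ.a γ.b := Icc_subset_Icc hs ht
      rw [withDensity_apply _ measurableSet_Icc, hlam, Measure.restrict_restrict measurableSet_Icc,
        inter_eq_left.2 hsub]
      exact setLIntegral_congr_fun measurableSet_Icc fun r hr => by rw [γ.extend_eq (hsub hr)]
    have main := edist_le_of_eqOn_measurableSet (f := fun t => u (γ.toFun t))
      (k := fun t => v (γ.toFun t)) γ.lt.le
      (α := lam.withDensity fun t => g (γ.extend t)) (β := lam.withDensity fun t => h (γ.extend t))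
      (fun s t hs hst ht => (hgle s t hs hst ht).trans (happ g s t hs ht).ge)
      (fun s t hs hst ht => (hhle s t hs hst ht).trans (happ h s t hs ht).ge)
      (hcont hE) (fun t ht h1 h2 => huv _ (by
        have : γ.extend t ∈ E := ht
        rwa [γ.extend_eq ⟨h1, h2⟩] at this))
    refine main.trans_eq ?_
    rw [withDensity_apply _ (hcont hE), withDensity_apply _ (hcont hE).compl,
      γ.lineIntegral_eq_extend, ← lintegral_add_compl (μ := lam)
        (fun t => E.piecewise h g (γ.extend t)) (hcont hE), add_comm]
    congr 1
    · exact setLIntegral_congr_fun (hcont hE) fun t ht => by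
        rw [piecewise_eq_of_mem _ _ _ (show γ.extend t ∈ E from ht)]
    · exact setLIntegral_congr_fun (hcont hE).compl fun t ht => by
        rw [piecewise_eq_of_notMem _ _ _ (show γ.extend t ∉ E from ht)]
  · refine lt_of_le_of_lt (b := ∫⁻ x, (h x ^ q + g x ^ q) ∂μ) (lintegral_mono fun x => ?_) ?_
    · by_cases hx : x ∈ E
      · simp [hx]
      · simp [hx]
    · rw [lintegral_add_left (hhm.pow_const q)]
      exact ENNReal.add_lt_top.2 ⟨hh.2, hg.2⟩

/-- Gluing with v = u: switch to h on the Borel set where h < g. -/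
theorem IsIntegrableWeakUpperGradient.inf [BorelSpace X] (hq : 0 < q) {u : X → ℝ}
    {g h : X → ℝ≥0∞} (hg : IsIntegrableWeakUpperGradient μ q u g)
    (hh : IsIntegrableWeakUpperGradient μ q u h) :
    IsIntegrableWeakUpperGradient μ q u (g ⊓ h) := by
  classical
  convert hg.piecewise hq hh (measurableSet_lt hh.1.1 hg.1.1) (fun _ _ => rfl) using 1
  ext x
  by_cases hx : h x < g x
  · simp [hx, hx.le]
  · simp [hx, not_lt.1 hx]

/-- Monotone convergence along almost every curve; the line integral of `g 0` is finite there, as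
decreasing limits require. -/
theorem IsIntegrableWeakUpperGradient.iInf [BorelSpace X] (hq : 0 < q) {u : X → ℝ}
    {g : ℕ → X → ℝ≥0∞} (hanti : Antitone g)
    (hg : ∀ n, IsIntegrableWeakUpperGradient μ q u (g n)) :
    IsIntegrableWeakUpperGradient μ q u (fun x => ⨅ n, g n x) := by
  have hgm := fun n => (hg n).1.1
  choose ρ hρ hρq hρ' using fun n => (hg n).exists_density hq
  obtain ⟨σ, hσ, hσq, hσ'⟩ := exists_common_density hq hρ hρq
  refine ⟨(isWeakUpperGradient_iff hq).2 ⟨Measurable.iInf hgm, σ, hσ, hσq, fun γ hγ => ?_⟩, ?_⟩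
  · have hfin := (hρ' 0 γ (hσ' γ hγ 0)).1
    rw [γ.lineIntegral_eq_extend] at hfin ⊢
    rw [lintegral_iInf (f := fun n t => g n (γ.extend t)) (fun n => (hgm n).comp γ.continuous_extend.measurable)
      (fun m n hmn t => hanti hmn _) hfin]
    refine le_iInf fun n => ?_
    rw [← γ.lineIntegral_eq_extend]
    exact (hρ' n γ (hσ' γ hγ n)).2 γ.a γ.b le_rfl γ.lt.le le_rfl
  · exact (lintegral_mono fun x => ENNReal.rpow_le_rpow (iInf_le _ 0) hq.le).trans_lt (hg 0).2

/-- Running minima of an energy-minimizing sequence decrease to an upper gradient G of least energy.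
For any competitor h, G ⊓ h has no smaller energy, so finiteness forces G ⊓ h = G almost everywhere.
-/
theorem exists_isMinimalWeakUpperGradient [BorelSpace X] (hq : 0 < q) {u : X → ℝ}
    (hu : MemDirichlet μ q u) : ∃ g, IsMinimalWeakUpperGradient μ q u g := by
  obtain ⟨g₀, hg₀⟩ := hu.2
  set S : Set ℝ≥0∞ := (fun g : X → ℝ≥0∞ => ∫⁻ x, g x ^ q ∂μ) ''
    {g | IsIntegrableWeakUpperGradient μ q u g} with hS
  obtain ⟨I, -, hI, hIS⟩ := exists_seq_tendsto_sInf (S := S) ⟨_, g₀, hg₀, rfl⟩ (OrderBot.bddBelow _)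
  choose g hg hgI using hIS
  have hGn : ∀ n, IsIntegrableWeakUpperGradient μ q u
      (fun x => (Finset.range (n + 1)).inf fun k => g k x) := by
    intro n
    induction n with
    | zero => simpa using hg 0
    | succ n ih =>
      convert (hg (n + 1)).inf hq ih using 1
      ext x
      rw [Finset.range_add_one, Finset.inf_insert]
      rfl
  have hanti : Antitone fun (n : ℕ) x => (Finset.range (n + 1)).inf fun k => g k x :=
    fun m n hmn x => Finset.inf_mono (Finset.range_mono (by omega))
  have hG := IsIntegrableWeakUpperGradient.iInf hq hanti hGn
  set G : X → ℝ≥0∞ := fun x => ⨅ n : ℕ, (Finset.range (n + 1)).inf fun k => g k x with hGdef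
  have hGle : ∫⁻ x, G x ^ q ∂μ ≤ sInf S := by
    refine ge_of_tendsto' hI fun n => ?_
    rw [← hgI n]
    refine lintegral_mono fun x => ENNReal.rpow_le_rpow ?_ hq.le
    exact (iInf_le _ n).trans (Finset.inf_le (Finset.mem_range.2 n.lt_succ_self))
  refine ⟨G, hG, fun h hh => ?_⟩
  have hmin := hG.inf hq hh
  have hle : ∫⁻ x, G x ^ q ∂μ ≤ ∫⁻ x, (G ⊓ h) x ^ q ∂μ := hGle.trans (sInf_le ⟨_, hmin, rfl⟩)
  have hae : (fun x => (G ⊓ h) x ^ q) =ᵐ[μ] fun x => G x ^ q :=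
    ae_eq_of_ae_le_of_lintegral_le
      (ae_of_all _ fun x => ENNReal.rpow_le_rpow inf_le_left hq.le) hmin.2.ne
      (hG.1.1.pow_const q).aemeasurable hle
  filter_upwards [hae] with x hx
  have : (G ⊓ h) x = G x := ENNReal.rpow_left_injective hq.ne' hx
  exact inf_eq_left.1 this

theorem isMinimalWeakUpperGradient_minGrad [BorelSpace X] (hq : 0 < q) {u : X → ℝ}
    (hu : MemDirichlet μ q u) : IsMinimalWeakUpperGradient μ q u (minGrad μ q u) := by
  have h := exists_isMinimalWeakUpperGradient hq hu
  rw [minGrad, dif_pos h]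
  exact h.choose_spec

theorem measurable_minGrad (μ : Measure X) (q : ℝ) (u : X → ℝ) : Measurable (minGrad μ q u) := by
  rw [minGrad]
  split_ifs with h
  · exact h.choose_spec.1.1.1
  · exact measurable_const

theorem IsIntegrableWeakUpperGradient.isometry_comp {v : X → ℝ} {g : X → ℝ≥0∞}
    (hg : IsIntegrableWeakUpperGradient μ q v g) {σ : ℝ → ℝ} (hσ : Isometry σ) :
    IsIntegrableWeakUpperGradient μ q (σ ∘ v) g := by
  refine ⟨⟨hg.1.1, ?_⟩, hg.2⟩
  simpa only [Function.comp_apply, hσ.edist_eq] using hg.1.2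

/-- Locality of the minimal weak upper gradient. -/
theorem minGrad_le_of_eq_isometry_comp [BorelSpace X] (hq : 0 < q) {u v : X → ℝ}
    (hu : MemDirichlet μ q u) (hv : MemDirichlet μ q v) {σ : ℝ → ℝ} (hσ : Isometry σ) :
    ∀ᵐ x ∂μ, u x = σ (v x) → minGrad μ q u x ≤ minGrad μ q v x := by
  classical
  -- The functions are only a.e. measurable, while gluing needs a Borel set; a Borel subset of the
  -- coincidence set that is a.e. equal to it suffices.
  have hnull : NullMeasurableSet {x | u x = (σ ∘ v) x} μ := nullMeasurableSet_eq_fun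
    hu.1
    (hσ.continuous.measurable.comp_aemeasurable hv.1)
  obtain ⟨E, hEsub, hE, hEae⟩ := hnull.exists_measurable_subset_ae_eq
  have hu' := isMinimalWeakUpperGradient_minGrad hq hu
  have hv' := isMinimalWeakUpperGradient_minGrad hq hv
  filter_upwards [hu'.2 _ (hu'.1.piecewise hq (hv'.1.isometry_comp hσ) hE hEsub), hEae.mem_iff]
    with x hx hxE hux
  rwa [piecewise_eq_of_mem _ _ _ (hxE.2 hux)] at hx

end Gluing

/-! ### Sawtooth functions and Lipschitz gluing -/

section Sawtooth

/-- The distance of `t` to `r ℤ`. -/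
noncomputable def sawtooth (r t : ℝ) : ℝ := |t - r * round (t / r)|

variable {r : ℝ}

theorem sawtooth_le_abs (hr : 0 < r) (t : ℝ) (n : ℤ) : sawtooth r t ≤ |t - r * n| := by
  have h (m : ℤ) : |t - r * m| = r * |t / r - m| := by
    rw [← abs_of_pos hr, ← abs_mul, abs_of_pos hr, mul_sub, mul_div_cancel₀ _ hr.ne']
  rw [sawtooth, h, h]
  exact mul_le_mul_of_nonneg_left (round_le _ _) hr.le

theorem sawtooth_le_half (hr : 0 < r) (t : ℝ) : sawtooth r t ≤ r / 2 := by
  have h : sawtooth r t = r * |t / r - round (t / r)| := by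
    rw [sawtooth, ← abs_of_pos hr, ← abs_mul, abs_of_pos hr, mul_sub, mul_div_cancel₀ _ hr.ne']
  rw [h]
  nlinarith [abs_sub_round (t / r)]

theorem lipschitzWith_sawtooth (hr : 0 < r) : LipschitzWith 1 (sawtooth r) :=
  LipschitzWith.of_le_add fun s t => by
    refine (sawtooth_le_abs hr s (round (t / r))).trans ?_
    rw [sawtooth, Real.dist_eq, add_comm]
    exact abs_sub_le _ _ _

end Sawtooth

section LipschitzGluing

variable {Y : Type*} [MetricSpace Y] {r : ℝ}

theorem lipschitzWith_sawtooth_comp (hr : 0 < r) {u : Y → ℝ} (hu : LipschitzWith 1 u) :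
    LipschitzWith 1 (fun y => sawtooth r (u y)) := by
  simpa [Function.comp_def] using (lipschitzWith_sawtooth hr).comp hu

/-- Small oscillating versions of two Lipschitz functions can be glued along separated sets
without increasing the Lipschitz constant. -/
theorem exists_lipschitzWith_one_gluing (hr : 0 < r) {F₁ F₂ : Set Y}
    (hsep : ∀ x ∈ F₁, ∀ y ∈ F₂, r ≤ dist x y) {u₁ u₂ : Y → ℝ}
    (h₁ : LipschitzWith 1 u₁) (h₂ : LipschitzWith 1 u₂) :
    ∃ w : Y → ℝ, LipschitzWith 1 w ∧ (∀ y ∈ F₁, w y = sawtooth r (u₁ y)) ∧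
      ∀ y ∈ F₂, w y = sawtooth r (u₂ y) := by
  -- Empty sets are treated apart because `Metric.infDist` to the empty set is 0, which would spoil
  -- the cutoff.
  rcases F₁.eq_empty_or_nonempty with rfl | hne₁
  · exact ⟨_, lipschitzWith_sawtooth_comp hr h₂, by simp, fun _ _ => rfl⟩
  rcases F₂.eq_empty_or_nonempty with rfl | hne₂
  · exact ⟨_, lipschitzWith_sawtooth_comp hr h₁, fun _ _ => rfl, by simp⟩
  -- This cutoff equals r/2 on F, so it does not affect the sawtooth there, and it is nonpositive at
  -- distance at least r/2 from F.
  have hcut : ∀ F : Set Y, LipschitzWith 1 fun y => r / 2 - Metric.infDist y F := fun F =>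
    LipschitzWith.of_le_add fun x y => by
      have := Metric.infDist_le_infDist_add_dist (s := F) (x := y) (y := x)
      rw [dist_comm] at this
      linarith
  have hv : ∀ (u : Y → ℝ) (F : Set Y), LipschitzWith 1 u → LipschitzWith 1 fun y =>
      max (min (sawtooth r (u y)) (r / 2 - Metric.infDist y F)) 0 := fun u F hu => by
    simpa using ((lipschitzWith_sawtooth_comp hr hu).min (hcut F)).max_const 0
  have hon : ∀ (u : Y → ℝ) (F : Set Y), ∀ y ∈ F,
      max (min (sawtooth r (u y)) (r / 2 - Metric.infDist y F)) 0 = sawtooth r (u y) := by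
    intro u F y hy
    rw [Metric.infDist_zero_of_mem hy, sub_zero, min_eq_left (sawtooth_le_half hr _),
      max_eq_left (abs_nonneg _)]
  have hoff : ∀ (u : Y → ℝ) (F : Set Y) (y : Y), r ≤ Metric.infDist y F →
      max (min (sawtooth r (u y)) (r / 2 - Metric.infDist y F)) 0 = 0 := by
    intro u F y hy
    exact max_eq_right ((min_le_right _ _).trans (by linarith))
  refine ⟨_, by simpa using (hv u₁ F₁ h₁).max (hv u₂ F₂ h₂), fun y hy => ?_, fun y hy => ?_⟩
  · rw [hon _ _ y hy, hoff _ _ y ((Metric.le_infDist hne₂).2 fun {z} hz => hsep y hy z hz)]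
    exact max_eq_left (abs_nonneg _)
  · rw [hon _ _ y hy, hoff _ _ y ((Metric.le_infDist hne₁).2 fun {z} hz => by
      rw [dist_comm]
      exact hsep z hz y hy)]
    exact max_eq_right (abs_nonneg _)

end LipschitzGluing

/-! ### Energy measures on the target -/

/-- Integration over preimages under a null measurable map defines a measure. -/
theorem exists_measure_eq_setLIntegral_preimage {X Y : Type*} [MeasurableSpace X]
    [MeasurableSpace Y] {μ : Measure X} {φ : X → Y} (hφ : NullMeasurable φ μ) (f : X → ℝ≥0∞) :
    ∃ m : Measure Y, ∀ B, MeasurableSet B → m B = ∫⁻ x in φ ⁻¹' B, f x ∂μ := by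
  -- Preimages of Borel sets are only null measurable, so the pushforward is taken from the
  -- completion.
  have hφ' : @Measurable (NullMeasurableSpace X (μ.withDensity f)) Y _ _ φ := fun B hB =>
    (hφ hB).mono_ac (withDensity_absolutelyContinuous μ f)
  refine ⟨@Measure.map (NullMeasurableSpace X (μ.withDensity f)) Y _ _ φ
    (μ.withDensity f).completion, fun B hB => ?_⟩
  rw [Measure.map_apply hφ' hB]
  exact withDensity_apply₀ f (hφ hB)

/-- At each point of φ⁻¹(F), u∘φ is rn + w∘φ or rn - w∘φ for an integer n. Locality applies to each
of these countably many isometries, outside a common null set. -/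
theorem setLIntegral_minGrad_le_of_eq_sawtooth {X Y : Type*} [MetricSpace X]
    [MeasurableSpace X] [BorelSpace X] {μ : Measure X} {q : ℝ} {φ : X → Y} (hq : 0 < q) {u w : Y → ℝ}
    (hu : MemDirichlet μ q (u ∘ φ)) (hw : MemDirichlet μ q (w ∘ φ)) {F : Set Y} {r : ℝ}
    (h : ∀ y ∈ F, w y = sawtooth r (u y)) :
    ∫⁻ x in φ ⁻¹' F, minGrad μ q (u ∘ φ) x ^ q ∂μ ≤
      ∫⁻ x in φ ⁻¹' F, minGrad μ q (w ∘ φ) x ^ q ∂μ := by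
  have hplus : ∀ n : ℤ, Isometry fun t : ℝ => r * n + t := fun n =>
    Isometry.of_dist_eq fun s t => dist_add_left _ _ _
  have hminus : ∀ n : ℤ, Isometry fun t : ℝ => r * n - t := fun n =>
    Isometry.of_dist_eq fun s t => dist_sub_left _ _ _
  refine setLIntegral_mono_ae ((measurable_minGrad μ q _).pow_const q).aemeasurable ?_
  filter_upwards [ae_all_iff.2 fun n => minGrad_le_of_eq_isometry_comp hq hu hw (hplus n),
    ae_all_iff.2 fun n => minGrad_le_of_eq_isometry_comp hq hu hw (hminus n)] with x hx₁ hx₂ hxF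
  refine ENNReal.rpow_le_rpow ?_ hq.le
  have hwx : w (φ x) = |u (φ x) - r * round (u (φ x) / r)| := h _ hxF
  rcases abs_choice (u (φ x) - r * round (u (φ x) / r)) with habs | habs
  · refine hx₁ (round (u (φ x) / r)) ?_
    simp only [Function.comp_apply]
    linarith
  · refine hx₂ (round (u (φ x) / r)) ?_
    simp only [Function.comp_apply]
    linarith

/-! ### Additivity of the set function -/

section SetFunction

variable {X Y : Type*} [MetricSpace X] [MeasurableSpace X] [MetricSpace Y]
  {μ : Measure X} {q : ℝ} {φ : X → Y}

theorem setLIntegral_minGrad_le_compSetFun {u : Y → ℝ} (hu : LipschitzWith 1 u) (B : Set Y) :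
    ∫⁻ x in φ ⁻¹' B, minGrad μ q (u ∘ φ) x ^ q ∂μ ≤ compSetFun μ q φ B :=
  le_iSup₂ (f := fun (u : Y → ℝ) (_ : LipschitzWith 1 u) =>
    ∫⁻ x in φ ⁻¹' B, minGrad μ q (u ∘ φ) x ^ q ∂μ) u hu

theorem compSetFun_mono {A B : Set Y} (hAB : A ⊆ B) : compSetFun μ q φ A ≤ compSetFun μ q φ B :=
  iSup₂_mono fun _ _ => lintegral_mono_set (preimage_mono hAB)

theorem compSetFun_empty : compSetFun μ q φ ∅ = 0 := by
  simp [compSetFun]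

theorem InducesBoundedCompLip.memDirichlet (h : InducesBoundedCompLip μ q φ) {u : Y → ℝ}
    (hu : LipschitzWith 1 u) : MemDirichlet μ q (u ∘ φ) := by
  obtain ⟨C, hC⟩ := h
  exact (hC u 1 hu).1

theorem InducesBoundedCompLip.compSetFun_lt_top (hq : 0 < q) (h : InducesBoundedCompLip μ q φ)
    (B : Set Y) : compSetFun μ q φ B < ∞ := by
  obtain ⟨C, hC⟩ := h
  refine lt_of_le_of_lt (b := (C : ℝ≥0∞) ^ q) (iSup₂_le fun u hu => ?_)
    (ENNReal.rpow_lt_top_of_nonneg hq.le ENNReal.coe_ne_top)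
  refine (setLIntegral_le_lintegral _ _).trans ?_
  have := (hC u 1 hu).2
  rwa [ENNReal.coe_one, mul_one, one_div, ENNReal.rpow_inv_le_iff hq] at this

variable [BorelSpace X] [MeasurableSpace Y]

theorem add_le_compSetFun_union_of_separated (hq : 0 < q) (hφ : NullMeasurable φ μ)
    (hcomp : InducesBoundedCompLip μ q φ) {F₁ F₂ : Set Y} (hF₂ : MeasurableSet F₂)
    {r : ℝ} (hr : 0 < r) (hsep : ∀ x ∈ F₁, ∀ y ∈ F₂, r ≤ dist x y)
    {u₁ u₂ : Y → ℝ} (h₁ : LipschitzWith 1 u₁) (h₂ : LipschitzWith 1 u₂) :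
    ∫⁻ x in φ ⁻¹' F₁, minGrad μ q (u₁ ∘ φ) x ^ q ∂μ +
      ∫⁻ x in φ ⁻¹' F₂, minGrad μ q (u₂ ∘ φ) x ^ q ∂μ ≤ compSetFun μ q φ (F₁ ∪ F₂) := by
  obtain ⟨w, hw, hw₁, hw₂⟩ := exists_lipschitzWith_one_gluing hr hsep h₁ h₂
  have hdisj : Disjoint F₁ F₂ := disjoint_left.2 fun x hx hx' => by
    have := hsep x hx x hx'
    rw [dist_self] at this
    linarith
  calc _ ≤ ∫⁻ x in φ ⁻¹' F₁, minGrad μ q (w ∘ φ) x ^ q ∂μ +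
        ∫⁻ x in φ ⁻¹' F₂, minGrad μ q (w ∘ φ) x ^ q ∂μ := add_le_add
          (setLIntegral_minGrad_le_of_eq_sawtooth hq (hcomp.memDirichlet h₁)
            (hcomp.memDirichlet hw) hw₁)
          (setLIntegral_minGrad_le_of_eq_sawtooth hq (hcomp.memDirichlet h₂)
            (hcomp.memDirichlet hw) hw₂)
    _ = ∫⁻ x in φ ⁻¹' (F₁ ∪ F₂), minGrad μ q (w ∘ φ) x ^ q ∂μ := by
        rw [preimage_union, Measure.restrict_union₀ (hdisj.preimage φ).aedisjoint (hφ hF₂),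
          lintegral_add_measure]
    _ ≤ _ := setLIntegral_minGrad_le_compSetFun hw _

variable [BorelSpace Y]

/-- The points of F₁ at distance at least 1/(n+1) from the closed set F₂ exhaust F₁. The separated
case passes to the limit by continuity of m from below. -/
theorem add_le_compSetFun_union_of_isClosed (hq : 0 < q) (hφ : NullMeasurable φ μ)
    (hcomp : InducesBoundedCompLip μ q φ) {F₁ F₂ : Set Y} (hF₂ : IsClosed F₂)
    (hdisj : Disjoint F₁ F₂) {u₁ u₂ : Y → ℝ} (h₁ : LipschitzWith 1 u₁) (h₂ : LipschitzWith 1 u₂)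
    {m : Measure Y} (hF₁ : MeasurableSet F₁)
    (hm : ∀ B, MeasurableSet B → m B = ∫⁻ x in φ ⁻¹' B, minGrad μ q (u₁ ∘ φ) x ^ q ∂μ) :
    m F₁ + ∫⁻ x in φ ⁻¹' F₂, minGrad μ q (u₂ ∘ φ) x ^ q ∂μ ≤ compSetFun μ q φ (F₁ ∪ F₂) := by
  set G : ℕ → Set Y := fun n =>
    F₁ ∩ {y | ENNReal.ofReal (1 / (n + 1)) ≤ Metric.infEDist y F₂} with hG
  have hGm : ∀ n, MeasurableSet (G n) := fun n => hF₁.inter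
    (measurableSet_le measurable_const Metric.continuous_infEDist.measurable)
  have hmono : Monotone G := fun k n hkn y hy => ⟨hy.1, le_trans (ENNReal.ofReal_le_ofReal
    (one_div_le_one_div_of_le (by positivity) (by gcongr))) hy.2⟩
  have hUnion : ⋃ n, G n = F₁ := by
    refine subset_antisymm (iUnion_subset fun n => inter_subset_left) fun y hy => ?_
    have hy₂ : y ∉ closure F₂ := by
      rw [hF₂.closure_eq]
      exact disjoint_left.1 hdisj hy
    obtain ⟨ε, hε, hlt⟩ := Metric.exists_real_pos_lt_infEDist_of_notMem_closure hy₂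
    obtain ⟨n, hn⟩ := exists_nat_one_div_lt hε
    exact mem_iUnion.2 ⟨n, hy, (ENNReal.ofReal_le_ofReal hn.le).trans hlt.le⟩
  rw [← hUnion, hmono.measure_iUnion, ENNReal.iSup_add, hUnion]
  refine iSup_le fun n => ?_
  rw [hm _ (hGm n)]
  refine (add_le_compSetFun_union_of_separated hq hφ hcomp hF₂.measurableSet
    (r := 1 / (n + 1)) (by positivity) (fun x hx y hy => ?_) h₁ h₂).trans
    (compSetFun_mono (union_subset_union_left _ inter_subset_left))
  have := hx.2.trans (Metric.infEDist_le_edist_of_mem hy)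
  rwa [edist_dist, ENNReal.ofReal_le_ofReal_iff dist_nonneg] at this

/-- For fixed competitors the energies are finite Borel measures on a metric space, so both sets may
be replaced by closed subsets up to ε. -/
theorem compSetFun_add_le_union (hq : 0 < q) (hφ : NullMeasurable φ μ)
    (hcomp : InducesBoundedCompLip μ q φ) {B₁ B₂ : Set Y} (hB₁ : MeasurableSet B₁)
    (hB₂ : MeasurableSet B₂) (hdisj : Disjoint B₁ B₂) :
    compSetFun μ q φ B₁ + compSetFun μ q φ B₂ ≤ compSetFun μ q φ (B₁ ∪ B₂) := by
  refine ENNReal.biSup_add_biSup_le' ⟨fun _ => 0, LipschitzWith.const' 0⟩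
    ⟨fun _ => 0, LipschitzWith.const' 0⟩ fun u₁ h₁ u₂ h₂ => ?_
  have hfin : ∀ (u : Y → ℝ), LipschitzWith 1 u → ∃ m : Measure Y, IsFiniteMeasure m ∧
      ∀ B, MeasurableSet B → m B = ∫⁻ x in φ ⁻¹' B, minGrad μ q (u ∘ φ) x ^ q ∂μ := by
    intro u hu
    obtain ⟨m, hm⟩ := exists_measure_eq_setLIntegral_preimage hφ
      fun x => minGrad μ q (u ∘ φ) x ^ q
    refine ⟨m, ⟨?_⟩, hm⟩
    rw [hm _ MeasurableSet.univ]
    exact (setLIntegral_minGrad_le_compSetFun hu _).trans_lt (hcomp.compSetFun_lt_top hq _)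
  obtain ⟨m₁, _, hm₁⟩ := hfin u₁ h₁
  obtain ⟨m₂, _, hm₂⟩ := hfin u₂ h₂
  rw [← hm₁ _ hB₁, ← hm₂ _ hB₂]
  refine ENNReal.le_of_forall_pos_le_add fun ε hε _ => ?_
  have hε2 : (ε / 2 : ℝ≥0∞) ≠ 0 := by simp [hε.ne']
  obtain ⟨F₁, hFB₁, hF₁, hlt₁⟩ := hB₁.exists_isClosed_lt_add (measure_ne_top m₁ B₁) hε2
  obtain ⟨F₂, hFB₂, hF₂, hlt₂⟩ := hB₂.exists_isClosed_lt_add (measure_ne_top m₂ B₂) hε2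
  calc m₁ B₁ + m₂ B₂ ≤ (m₁ F₁ + ε / 2) + (m₂ F₂ + ε / 2) := add_le_add hlt₁.le hlt₂.le
    _ = m₁ F₁ + m₂ F₂ + ε := by rw [add_add_add_comm, ENNReal.add_halves]
    _ ≤ compSetFun μ q φ (B₁ ∪ B₂) + ε := by
        gcongr
        rw [hm₂ _ hF₂.measurableSet]
        exact (add_le_compSetFun_union_of_isClosed hq hφ hcomp hF₂ (hdisj.mono hFB₁ hFB₂) h₁ h₂
          hF₁.measurableSet hm₁).trans (compSetFun_mono (union_subset_union hFB₁ hFB₂))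

/-- The upper bound is countable additivity for each competitor separately. The lower bound needs
only finite superadditivity and monotonicity, since the sum is the supremum of its partial sums. -/
theorem compSetFun_iUnion (hq : 0 < q) (hφ : NullMeasurable φ μ)
    (hcomp : InducesBoundedCompLip μ q φ) {B : ℕ → Set Y} (hB : ∀ n, MeasurableSet (B n))
    (hdisj : Pairwise (Function.onFun Disjoint B)) :
    compSetFun μ q φ (⋃ n, B n) = ∑' n, compSetFun μ q φ (B n) := by
  apply le_antisymm
  · refine iSup₂_le fun u hu => ?_
    obtain ⟨m, hm⟩ := exists_measure_eq_setLIntegral_preimage hφ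
      fun x => minGrad μ q (u ∘ φ) x ^ q
    rw [← hm _ (MeasurableSet.iUnion hB), measure_iUnion hdisj hB]
    refine ENNReal.tsum_le_tsum fun n => ?_
    rw [hm _ (hB n)]
    exact setLIntegral_minGrad_le_compSetFun hu _
  · rw [ENNReal.tsum_eq_iSup_nat]
    refine iSup_le fun n => le_trans ?_
      (compSetFun_mono (iUnion₂_subset_iUnion (fun i => i ∈ Finset.range n) B))
    induction n with
    | zero => simp
    | succ n ih =>
      rw [Finset.sum_range_succ]
      refine (add_le_add ih le_rfl).trans ((compSetFun_add_le_union hq hφ hcomp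
        (Finset.measurableSet_biUnion _ fun i _ => hB i) (hB n) ?_).trans (compSetFun_mono ?_))
      · simp only [disjoint_iUnion_left]
        exact fun i hi => hdisj (Finset.mem_range.1 hi).ne
      · refine union_subset (biUnion_subset_biUnion_left fun i hi => ?_) fun y hy => ?_
        · exact Finset.mem_range.2 ((Finset.mem_range.1 hi).trans n.lt_succ_self)
        · exact mem_iUnion₂.2 ⟨n, Finset.mem_range.2 n.lt_succ_self, hy⟩

end SetFunction

theorem mainTheorem5 {X Y : Type*}
    [MetricSpace X] [TopologicalSpace.SeparableSpace X] [MeasurableSpace X] [BorelSpace X]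
    [MetricSpace Y] [TopologicalSpace.SeparableSpace Y] [MeasurableSpace Y] [BorelSpace Y]
    (μ : Measure X) (hμ : IsMetricMeasure μ) (ν : Measure Y) (hν : IsMetricMeasure ν)
    (q : ℝ) (hq : 1 ≤ q)
    (φ : X → Y) (hφ : NullMeasurable φ μ) (hcomp : InducesBoundedCompLip μ q φ) :
    ∃ Ψ : Measure Y,
      (∀ A : Set Y, Ψ A =
        ⨅ (B : Set Y) (_ : A ⊆ B) (_ : MeasurableSet B), compSetFun μ q φ B) ∧
      (∀ B : Set Y, MeasurableSet B → Ψ B = compSetFun μ q φ B) ∧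
      IsFiniteMeasure Ψ ∧
      (∀ A : Set Y, ∃ B : Set Y, A ⊆ B ∧ MeasurableSet B ∧ Ψ B = Ψ A) := by
  have hq0 : 0 < q := one_pos.trans_le hq
  -- The measure built from Ψ on Borel sets gives every other set the infimum over its Borel
  -- supersets, which is the required extension formula.
  let Ψ : Measure Y := Measure.ofMeasurable (fun B _ => compSetFun μ q φ B) compSetFun_empty
    fun B hB hdisj => compSetFun_iUnion hq0 hφ hcomp hB hdisj
  have hΨ : ∀ B, MeasurableSet B → Ψ B = compSetFun μ q φ B := fun B hB =>
    Measure.ofMeasurable_apply B hB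
  refine ⟨Ψ, fun A => ?_, hΨ, ⟨?_⟩, fun A => ?_⟩
  · rw [measure_eq_iInf]
    exact iInf_congr fun B => iInf_congr fun _ => iInf_congr fun hB => hΨ B hB
  · rw [hΨ _ MeasurableSet.univ]
    exact hcomp.compSetFun_lt_top hq0 _
  · exact ⟨toMeasurable Ψ A, subset_toMeasurable Ψ A, measurableSet_toMeasurable Ψ A,
      measure_toMeasurable A⟩
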